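/- For $n\ge 1$ let $J_n$ be the cactus group, generated by $\sigma_{p,q}$ ($1\le p<q\le n$) subject to the relations $\sigma_{p,q}^2=1$; $\sigma_{p,q}\sigma_{r,s}=\sigma_{r,s}\sigma_{p,q}$ if $[p,q]\cap[r,s]=\emptyset$; and $\sigma_{p,q}\sigma_{r,s}=\sigma_{p+q-s,\,p+q-r}\,\sigma_{p,q}$ if $[r,s]\subseteq[p,q]$, where $[p,q]=\{p,p+1,\dots,q\}$. Write $\sigma_i=\sigma_{1,i}$ for $2\le i\le n$, $[g,h]=g^{-1}h^{-1}gh$ and $[g,h,k]=[[g,h],k]$, and let $\Gamma_1(G)=G$, $\Gamma_{m+1}(G)=[\Gamma_m(G),G]$ be the lower central series of a group $G$. Then for every $n\ge 3$ the group $J_n/\Gamma_3(J_n)$ has order $2^{\lfloor n/2\rfloor+n-1}$, and it is presented by the generators $\sigma_2,\dots,\sigma_n$ (the classes of these elements of $J_n$) subject to the relations \begin{align*} \sigma_i^2&=1 && \text{for } 2\le i\le n,\\ [\sigma_i,\sigma_j]&=1 && \text{for } 2\le i,j\le n \text{ with } i<\lfloor\tfrac{n+1}{2}\rfloor \text{ or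 } j\equiv i \pmod 2,\\ [\sigma_i,\sigma_j,\sigma_k]&=1 && \text{for } 2\le i,j,k\le n,\\ [\sigma_i,\sigma_j]&=[\sigma_i,\sigma_k] && \text{for } 2\le i\le j,k\le n \text{ with } k\equiv j \pmod 2. \end{align*} In particular, $J_4/\Gamma_3(J_4)\cong\mathbb{Z}_2^2\wr\mathbb{Z}_2$ and $J_5/\Gamma_3(J_5)\cong\mathbb{Z}_2\times(\mathbb{Z}_2^2\wr\mathbb{Z}_2)$, where $\wr$ denotes the regular wreath product, $\mathbb{Z}_2^2\wr\mathbb{Z}_2=(\mathbb{Z}_2^2\times\mathbb{Z}_2^2)\rtimes\mathbb{Z}_2$ with $\mathbb{Z}_2$ exchanging the two factors. -/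

import Mathlib

namespace Cactus

/-- The index set of the generators `σ_{p,q}`, `1 ≤ p < q ≤ n`, of the cactus group `J_n`. -/
@[ext]
structure Gen (n : ℕ) where
  p : ℕ
  q : ℕ
  one_le : 1 ≤ p
  lt : p < q
  le : q ≤ n

/-- For `[r,s] ⊆ [p,q]`, the index `(p+q-s, p+q-r)` of the mirror image of `[r,s]` in `[p,q]`. -/
def Gen.reflect {n : ℕ} (a b : Gen n) (hp : a.p ≤ b.p) (hq : b.q ≤ a.q) : Gen n where
  p := a.p + a.q - b.q
  q := a.p + a.q - b.p
  one_le := by have := a.one_le; omega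
  lt := by have := b.lt; omega
  le := by have := a.le; omega

/-- The relators of the standard presentation of `J_n`; a relation `u = v` is recorded as the
relator `u * v⁻¹`. -/
inductive IsRelator (n : ℕ) : FreeGroup (Gen n) → Prop
  /-- `σ_{p,q}² = 1`. -/
  | sq (a : Gen n) : IsRelator n (FreeGroup.of a ^ 2)
  /-- `σ_{p,q} σ_{r,s} = σ_{r,s} σ_{p,q}` if `[p,q] ∩ [r,s] = ∅`. -/
  | disjoint (a b : Gen n) (h : a.q < b.p ∨ b.q < a.p) :
      IsRelator n ((FreeGroup.of a * FreeGroup.of b) * (FreeGroup.of b * FreeGroup.of a)⁻¹)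
  /-- `σ_{p,q} σ_{r,s} = σ_{p+q-s,p+q-r} σ_{p,q}` if `[r,s] ⊆ [p,q]`. -/
  | nested (a b : Gen n) (hp : a.p ≤ b.p) (hq : b.q ≤ a.q) :
      IsRelator n ((FreeGroup.of a * FreeGroup.of b) *
        (FreeGroup.of (a.reflect b hp hq) * FreeGroup.of a)⁻¹)

/-- The cactus group `J_n`. -/
abbrev J (n : ℕ) : Type := PresentedGroup {w : FreeGroup (Gen n) | IsRelator n w}

/-- The element `σ_i = σ_{1,i}` of `J_n`, for `2 ≤ i ≤ n`. -/
def sigma {n : ℕ} (i : Set.Icc 2 n) : J n :=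
  PresentedGroup.of ⟨1, i, le_rfl, i.2.1, i.2.2⟩

/-- The term `Γ_k(G)` of the lower central series of `G`, with `Γ_1(G) = G` and
`Γ_{k+1}(G) = [Γ_k(G), G]` for `k ≥ 1` (the library counts from `0`). -/
abbrev Gamma (k : ℕ) (G : Type*) [Group G] : Subgroup G :=
  (⊤ : Subgroup G).lowerCentralSeries (k - 1)

/-- The commutator `[g,h] = g⁻¹h⁻¹gh`. -/
def comm {G : Type*} [Group G] (g h : G) : G := g⁻¹ * h⁻¹ * g * h

/-- The relators of the explicit presentation of `J_n/Γ_3(J_n)`, as words in free generators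
`x_2, …, x_n`; a relation `u = v` is recorded as the relator `u * v⁻¹`. -/
inductive IsQuotientRelator (n : ℕ) : FreeGroup (Set.Icc 2 n) → Prop
  /-- `x_i² = 1`. -/
  | sq (i : Set.Icc 2 n) : IsQuotientRelator n (FreeGroup.of i ^ 2)
  /-- `[x_i, x_j] = 1` if `i < ⌊(n+1)/2⌋` or `j ≡ i mod 2`. -/
  | comm (i j : Set.Icc 2 n) (h : (i : ℕ) < (n + 1) / 2 ∨ (j : ℕ) ≡ i [MOD 2]) :
      IsQuotientRelator n (Cactus.comm (FreeGroup.of i) (FreeGroup.of j))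
  /-- `[[x_i, x_j], x_k] = 1`. -/
  | triple (i j k : Set.Icc 2 n) :
      IsQuotientRelator n
        (Cactus.comm (Cactus.comm (FreeGroup.of i) (FreeGroup.of j)) (FreeGroup.of k))
  /-- `[x_i, x_j] = [x_i, x_k]` if `i ≤ j`, `i ≤ k` and `k ≡ j mod 2`. -/
  | parity (i j k : Set.Icc 2 n) (hj : (i : ℕ) ≤ j) (hk : (i : ℕ) ≤ k)
      (h : (k : ℕ) ≡ j [MOD 2]) :
      IsQuotientRelator n
        (Cactus.comm (FreeGroup.of i) (FreeGroup.of j) *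
          (Cactus.comm (FreeGroup.of i) (FreeGroup.of k))⁻¹)

/-- The cyclic group of order two, written multiplicatively. -/
abbrev Z2 : Type := Multiplicative (ZMod 2)

end Cactus

/-! Reflecting `[1,q-p+1]` in `[1,q]` gives `[p,q]`, so `σ_{p,q}` is a conjugate of `σ_{q-p+1}` and
equals `x_{q-p+1} [x_{q-p+1}, x_q]` with `x_i = σ_i` (`eq_mul_comm`). Modulo `Γ_3` commutators are
central, and those of involutions have order at most two. After this substitution the cactus
relations become statements about the `[x_m, x_l]` alone: for `m ≤ l` the value depends only on the
parity of `l - m`, is trivial when `l - m` is even, and is trivial throughout when `2m + 1 ≤ n`.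
Conversely, in a group of class two these rules give back all cactus relations
(`QuotientRelations.cactusRelations`), whence the presentation.

For the order, the `⌊n/2⌋` commutators `[x_m, x_{m+1}]` with `⌊(n+1)/2⌋ ≤ m < n` generate a central
subgroup with quotient generated by `n - 1` commuting involutions, which bounds the order above. A
central extension built from a bilinear cocycle has exactly this order and satisfies the relations.
The two examples follow from explicit generators and a comparison of orders. -/

namespace Cactus

/-! ### Commutator calculus in nilpotency class two -/

section ClassTwo

variable {G : Type*} [Group G]

/-- A group is nilpotent of class at most two if its commutators are central. -/
def IsClassTwo (G : Type*) [Group G] : Prop :=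
  ∀ a b c : G, Commute (comm a b) c

theorem map_comm {H : Type*} [Group H] (f : G →* H) (a b : G) :
    f (comm a b) = comm (f a) (f b) := by
  simp [comm]

theorem comm_eq_one_iff {a b : G} : comm a b = 1 ↔ Commute a b := by
  constructor
  · intro h
    have : b * a * comm a b = a * b := by simp [comm, mul_assoc]
    rw [h, mul_one] at this
    exact this.symm
  · intro h
    rw [comm, mul_assoc, h.eq]
    group

@[simp]
theorem comm_self (a : G) : comm a a = 1 :=
  comm_eq_one_iff.2 (Commute.refl a)

theorem comm_inv (a b : G) : (comm a b)⁻¹ = comm b a := by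
  simp [comm, mul_assoc]

theorem mul_comm_eq (a b : G) : a * b = b * a * comm a b := by
  simp [comm, mul_assoc]

theorem IsClassTwo.comm_mul_left (hG : IsClassTwo G) (a b c : G) :
    comm (a * b) c = comm a c * comm b c := by
  have h : comm (a * b) c = b⁻¹ * (comm a c * b) * comm b c := by
    simp [comm, mul_assoc]
  rw [h, (hG a c b).eq, inv_mul_cancel_left]

theorem IsClassTwo.comm_sq (hG : IsClassTwo G) {a : G} (ha : a ^ 2 = 1) (b : G) :
    comm a b * comm a b = 1 := by
  rw [← hG.comm_mul_left, ← sq, ha]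
  simp [comm]

theorem IsClassTwo.comm_symm (hG : IsClassTwo G) {a : G} (ha : a ^ 2 = 1) (b : G) :
    comm b a = comm a b := by
  rw [← comm_inv a b]
  exact inv_eq_of_mul_eq_one_left (hG.comm_sq ha b)

end ClassTwo

/-- A family of elements satisfying the defining relations of the cactus group. -/
structure CactusRelations {n : ℕ} {G : Type*} [Group G] (f : Gen n → G) : Prop where
  sq (a : Gen n) : f a ^ 2 = 1
  disjoint (a b : Gen n) (h : a.q < b.p ∨ b.q < a.p) : f a * f b = f b * f a
  nested (a b : Gen n) (hp : a.p ≤ b.p) (hq : b.q ≤ a.q) :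
    f a * f b = f (a.reflect b hp hq) * f a

/-- A family of elements satisfying the relations of the presentation of `J_n/Γ_3(J_n)`. -/
structure QuotientRelations {n : ℕ} {G : Type*} [Group G] (x : Set.Icc 2 n → G) : Prop where
  sq (i : Set.Icc 2 n) : x i ^ 2 = 1
  comm (i j : Set.Icc 2 n) (h : (i : ℕ) < (n + 1) / 2 ∨ (j : ℕ) ≡ i [MOD 2]) :
    Cactus.comm (x i) (x j) = 1
  triple (i j k : Set.Icc 2 n) : Cactus.comm (Cactus.comm (x i) (x j)) (x k) = 1
  parity (i j k : Set.Icc 2 n) (hj : (i : ℕ) ≤ j) (hk : (i : ℕ) ≤ k)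
    (h : (k : ℕ) ≡ j [MOD 2]) : Cactus.comm (x i) (x j) = Cactus.comm (x i) (x k)

/-- The index of `σ_i = σ_{1,i}`. -/
def Gen.initial {n : ℕ} (i : Set.Icc 2 n) : Gen n :=
  ⟨1, i, le_rfl, i.2.1, i.2.2⟩

/-- The length `q - p + 1` of the interval `[p,q]`. -/
def Gen.length {n : ℕ} (a : Gen n) : Set.Icc 2 n :=
  ⟨a.q - a.p + 1, by have := a.lt; omega, by have := a.one_le; have := a.le; have := a.lt; omega⟩

/-- The right end `q` of the interval `[p,q]`. -/
def Gen.right {n : ℕ} (a : Gen n) : Set.Icc 2 n :=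
  ⟨a.q, by have := a.lt; have := a.one_le; omega, a.le⟩

/-! ### Equivalence of the two systems of relations in class two -/

section Relations

variable {n : ℕ} {G : Type*} [Group G]

theorem CactusRelations.eq_mul_comm {f : Gen n → G} (hf : CactusRelations f) (a : Gen n) :
    f a = f (Gen.initial a.length) *
      comm (f (Gen.initial a.length)) (f (Gen.initial a.right)) := by
  have h1 := a.one_le
  have h2 := a.lt
  have h := hf.nested (Gen.initial a.right) (Gen.initial a.length) le_rfl
    (by simp only [Gen.initial, Gen.length, Gen.right]; omega)
  have e : (Gen.initial a.right).reflect (Gen.initial a.length) le_rfl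
      (by simp only [Gen.initial, Gen.length, Gen.right]; omega) = a := by
    ext <;> simp only [Gen.reflect, Gen.initial, Gen.length, Gen.right] <;> omega
  rw [e] at h
  have hy : (f (Gen.initial a.right))⁻¹ = f (Gen.initial a.right) :=
    inv_eq_of_mul_eq_one_left (by rw [← _root_.sq]; exact hf.sq _)
  have h' : f a = f (Gen.initial a.right) * f (Gen.initial a.length) *
    (f (Gen.initial a.right))⁻¹ := by rw [h]; group
  rw [h', comm]
  -- With `y` the involution attached to the right end and `x` the one attached to the length, `y *
  -- x * y⁻¹ = y⁻¹ * x * y = x * comm x y`.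
  nth_rewrite 1 [← hy]
  nth_rewrite 2 [hy]
  group

/-- Reflection in `[1,l+1]` carries `[l+1-m,l]` to `[2,m+1]`. Both have length `m`, so `eq_mul_comm`
turns this nested relation into one between commutators of `x_m`. -/
theorem CactusRelations.comm_succ (hG : IsClassTwo G) {f : Gen n → G} (hf : CactusRelations f)
    (m m' l l' : Set.Icc 2 n) (hm : (m' : ℕ) = m + 1) (hl : (l' : ℕ) = l + 1)
    (hml : (m : ℕ) ≤ l) :
    comm (f (Gen.initial m)) (f (Gen.initial l')) =
      comm (f (Gen.initial m)) (f (Gen.initial l)) *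
        comm (f (Gen.initial m)) (f (Gen.initial m')) := by
  obtain ⟨m, hm2, hmn⟩ := m
  obtain ⟨m', hm2', hmn'⟩ := m'
  obtain ⟨l, hl2, hln⟩ := l
  obtain ⟨l', hl2', hln'⟩ := l'
  dsimp only at hm hl hml
  subst hm hl
  set a : Gen n := ⟨1, l + 1, le_rfl, hl2', hln'⟩ with ha
  set b : Gen n := ⟨l + 1 - m, l, by omega, by omega, hln⟩ with hb
  set c : Gen n := ⟨2, m + 1, by omega, by omega, hmn'⟩ with hc
  have h := hf.nested a b (by simp only [ha, hb]; omega) (by simp only [ha, hb]; omega)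
  have e : a.reflect b (by simp only [ha, hb]; omega) (by simp only [ha, hb]; omega) = c := by
    ext <;> simp only [Gen.reflect, ha, hb, hc] <;> omega
  have eb : b.length = ⟨m, hm2, hmn⟩ := by
    apply Subtype.ext; simp only [Gen.length, hb]; omega
  have ec : c.length = ⟨m, hm2, hmn⟩ := by
    apply Subtype.ext; simp only [Gen.length, hc]; omega
  rw [e, hf.eq_mul_comm b, hf.eq_mul_comm c, eb, ec] at h
  change f (Gen.initial ⟨l + 1, hl2', hln'⟩) * (f (Gen.initial ⟨m, hm2, hmn⟩) *
    comm (f (Gen.initial ⟨m, hm2, hmn⟩)) (f (Gen.initial ⟨l, hl2, hln⟩))) =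
    f (Gen.initial ⟨m, hm2, hmn⟩) *
    comm (f (Gen.initial ⟨m, hm2, hmn⟩)) (f (Gen.initial ⟨m + 1, hm2', hmn'⟩)) *
    f (Gen.initial ⟨l + 1, hl2', hln'⟩) at h
  set x := f (Gen.initial ⟨m, hm2, hmn⟩) with hx
  set y := f (Gen.initial ⟨l + 1, hl2', hln'⟩)
  set z := comm x (f (Gen.initial ⟨l, hl2, hln⟩))
  set w := comm x (f (Gen.initial ⟨m + 1, hm2', hmn'⟩)) with hw
  have hww : w * w = 1 := hG.comm_sq (hf.sq _) _
  rw [mul_assoc x w y, (show w * y = y * w from hG _ _ y)] at h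
  have h' : z = comm x y * w := by
    rw [comm]
    calc z = x⁻¹ * y⁻¹ * (y * (x * z)) := by group
      _ = _ := by rw [h]; group
  rw [h', mul_assoc, hww, mul_one]

/-- Two applications of `comm_succ` contribute the factor `[x_m, x_{m+1}]` twice, and its square is
trivial. -/
theorem CactusRelations.comm_add_two (hG : IsClassTwo G) {f : Gen n → G}
    (hf : CactusRelations f) (t : ℕ) : ∀ m j k : Set.Icc 2 n, (m : ℕ) ≤ j → (k : ℕ) = j + 2 * t →
    comm (f (Gen.initial m)) (f (Gen.initial k)) =
      comm (f (Gen.initial m)) (f (Gen.initial j)) := by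
  induction t with
  | zero =>
    intro m j k _ hk
    rw [show k = j from Subtype.ext (by simpa using hk)]
  | succ t ih =>
    intro m j k hj hk
    have hkn := k.2.2
    have hm2 := m.2.1
    let k₁ : Set.Icc 2 n := ⟨j + 2 * t + 1, by omega, by omega⟩
    let k₀ : Set.Icc 2 n := ⟨j + 2 * t, by omega, by omega⟩
    let m₁ : Set.Icc 2 n := ⟨m + 1, by omega, by omega⟩
    rw [hf.comm_succ hG m m₁ k₁ k rfl (by simp only [k₁]; omega) (by simp only [k₁]; omega),
      hf.comm_succ hG m m₁ k₀ k₁ rfl rfl (by simp only [k₀]; omega), mul_assoc,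
      hG.comm_sq (hf.sq _), mul_one]
    exact ih m j k₀ hj rfl

theorem CactusRelations.comm_parity (hG : IsClassTwo G) {f : Gen n → G}
    (hf : CactusRelations f) (m j k : Set.Icc 2 n) (hj : (m : ℕ) ≤ j) (hk : (m : ℕ) ≤ k)
    (h : (k : ℕ) ≡ j [MOD 2]) :
    comm (f (Gen.initial m)) (f (Gen.initial j)) =
      comm (f (Gen.initial m)) (f (Gen.initial k)) := by
  unfold Nat.ModEq at h
  rcases le_total (j : ℕ) k with hjk | hjk
  · exact (hf.comm_add_two hG ((k - j) / 2) m j k hj (by omega)).symm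
  · exact hf.comm_add_two hG ((j - k) / 2) m k j hk (by omega)

/-- The interval `[m+1,2m+1]` is disjoint from `[1,m]`, has length `m + 1`, and fits when `2m + 1 ≤
n`; its generator is `x_{m+1}` up to a central factor. -/
theorem CactusRelations.comm_succ_eq_one (hG : IsClassTwo G) {f : Gen n → G}
    (hf : CactusRelations f) (m l : Set.Icc 2 n) (hl : (l : ℕ) = m + 1) (h : 2 * (m : ℕ) + 1 ≤ n) :
    comm (f (Gen.initial m)) (f (Gen.initial l)) = 1 := by
  have hm2 := m.2.1
  set a : Gen n := ⟨m + 1, 2 * m + 1, by omega, by omega, h⟩ with ha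
  have hd := hf.disjoint (Gen.initial m) a (Or.inl (by simp only [Gen.initial, ha]; omega))
  have ea : a.length = l := by
    apply Subtype.ext; simp only [Gen.length, ha]; omega
  rw [hf.eq_mul_comm a, ea] at hd
  set x := f (Gen.initial m)
  set y := f (Gen.initial l)
  set z := comm y (f (Gen.initial a.right))
  rw [mul_assoc y z x, (show z * x = x * z from hG _ _ _), ← mul_assoc, ← mul_assoc] at hd
  exact comm_eq_one_iff.2 (mul_right_cancel hd)

theorem CactusRelations.comm_eq_one_of_le (hG : IsClassTwo G) {f : Gen n → G}
    (hf : CactusRelations f) (i j : Set.Icc 2 n) (hij : (i : ℕ) ≤ j)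
    (h : (i : ℕ) < (n + 1) / 2 ∨ (j : ℕ) ≡ i [MOD 2]) :
    comm (f (Gen.initial i)) (f (Gen.initial j)) = 1 := by
  have hi2 := i.2.1
  by_cases hp : (j : ℕ) ≡ i [MOD 2]
  · rw [← hf.comm_parity hG i i j le_rfl hij hp, comm_self]
  · have hi := h.resolve_right hp
    unfold Nat.ModEq at hp
    let l : Set.Icc 2 n := ⟨i + 1, by omega, by omega⟩
    rw [hf.comm_parity hG i j l hij (by simp only [l]; omega)
      (by simp only [l, Nat.ModEq]; omega)]
    exact hf.comm_succ_eq_one hG i l rfl (by omega)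

theorem CactusRelations.quotientRelations (hG : IsClassTwo G) {f : Gen n → G}
    (hf : CactusRelations f) : QuotientRelations fun i => f (Gen.initial i) where
  sq i := hf.sq _
  comm i j h := by
    rcases le_total (i : ℕ) j with hij | hij
    · exact hf.comm_eq_one_of_le hG i j hij h
    · rw [hG.comm_symm (hf.sq _)]
      exact hf.comm_eq_one_of_le hG j i hij (h.imp (fun h => by omega) Nat.ModEq.symm)
  triple i j k := comm_eq_one_iff.2 (hG _ _ _)
  parity i j k hj hk h := hf.comm_parity hG i j k hj hk h

/-- The elements `x_q⁻¹ x_{q-p+1} x_q` attached to a family `x_2, …, x_n`. -/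
def extend (x : Set.Icc 2 n → G) (a : Gen n) : G :=
  x a.length * comm (x a.length) (x a.right)

theorem extend_initial (x : Set.Icc 2 n → G) (i : Set.Icc 2 n) :
    extend x (Gen.initial i) = x i := by
  have e : (Gen.initial i).length = i := by
    have := i.2.1
    apply Subtype.ext; simp only [Gen.length, Gen.initial]; omega
  have e' : (Gen.initial i).right = i := rfl
  rw [extend, e, e', comm_self, mul_one]

theorem CactusRelations.extend_eq {f : Gen n → G} (hf : CactusRelations f) :
    extend (fun i => f (Gen.initial i)) = f :=
  funext fun a => (hf.eq_mul_comm a).symm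

/-- For `k ≥ m`, `[x_m, x_k]` is a homomorphic function of `k - m` mod 2, and the congruence says
`(l - m) + (s - m) ≡ t - m`. This is what the nested relation amounts to. -/
theorem QuotientRelations.comm_mul_comm (hG : IsClassTwo G) {x : Set.Icc 2 n → G}
    (hx : QuotientRelations x) (m l s t : Set.Icc 2 n) (hl : (m : ℕ) ≤ l) (hs : (m : ℕ) ≤ s)
    (ht : (m : ℕ) ≤ t) (h : ((s : ℕ) + t) ≡ m + l [MOD 2]) :
    Cactus.comm (x l) (x m) * Cactus.comm (x m) (x s) = Cactus.comm (x m) (x t) := by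
  rw [hG.comm_symm (hx.sq m) (x l)]
  unfold Nat.ModEq at h
  by_cases hs' : (s : ℕ) ≡ m [MOD 2]
  · rw [hx.comm m s (Or.inr hs'), mul_one]
    unfold Nat.ModEq at hs'
    exact hx.parity m l t hl ht (by unfold Nat.ModEq; omega)
  · by_cases hl' : (l : ℕ) ≡ m [MOD 2]
    · rw [hx.comm m l (Or.inr hl'), one_mul]
      unfold Nat.ModEq at hs' hl'
      exact hx.parity m s t hs ht (by unfold Nat.ModEq; omega)
    · unfold Nat.ModEq at hs' hl'
      rw [hx.comm m t (Or.inr (by unfold Nat.ModEq; omega)),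
        hx.parity m l s hl hs (by unfold Nat.ModEq; omega)]
      exact hG.comm_sq (hx.sq m) _

/-- Disjoint intervals have lengths of sum at most `n`; if these differ in parity, the smaller one
lies below `⌊(n+1)/2⌋`. -/
theorem QuotientRelations.commute_of_add_le {x : Set.Icc 2 n → G}
    (hx : QuotientRelations x) (m l : Set.Icc 2 n) (h : (m : ℕ) + l ≤ n) :
    Commute (x m) (x l) := by
  by_cases hp : (l : ℕ) ≡ m [MOD 2]
  · exact comm_eq_one_iff.1 (hx.comm m l (Or.inr hp))
  · unfold Nat.ModEq at hp
    rcases lt_or_ge (m : ℕ) l with hml | hml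
    · exact comm_eq_one_iff.1 (hx.comm m l (Or.inl (by omega)))
    · exact (comm_eq_one_iff.1 (hx.comm l m (Or.inl (by omega)))).symm

theorem QuotientRelations.cactusRelations (hG : IsClassTwo G) {x : Set.Icc 2 n → G}
    (hx : QuotientRelations x) : CactusRelations (extend x) where
  sq a := by
    have h := hG.comm_sq (hx.sq a.length) (x a.right)
    have hc := hG (x a.length) (x a.right) (x a.length)
    rw [extend, hc.symm.mul_pow, hx.sq, one_mul, _root_.sq, h]
  disjoint a b h := by
    have ha := a.lt
    have hb := b.lt
    have ha' := a.le
    have hb' := b.le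
    have ha1 := a.one_le
    have hb1 := b.one_le
    have hc : Commute (x a.length) (x b.length) :=
      hx.commute_of_add_le _ _ (by simp only [Gen.length]; omega)
    exact ((hc.mul_left (hG _ _ _)).mul_right ((hG _ _ _).symm)).eq
  nested a b hp hq := by
    have ha := a.lt
    have hb := b.lt
    have e : (a.reflect b hp hq).length = b.length := by
      apply Subtype.ext; simp only [Gen.length, Gen.reflect]; omega
    -- The right ends of `b` and of its mirror image add up to `b.q - b.p + a.p + a.q`, which has
    -- the parity of the sum of the two lengths.
    have key := hx.comm_mul_comm hG b.length a.length b.right (a.reflect b hp hq).right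
      (by simp only [Gen.length]; omega)
      (by have := b.one_le; simp only [Gen.length, Gen.right]; omega)
      (by have := a.one_le; simp only [Gen.length, Gen.right, Gen.reflect]; omega)
      (by simp only [Gen.length, Gen.right, Gen.reflect, Nat.ModEq]; omega)
    simp only [extend, e]
    rw [← key]
    set l := x a.length
    set m := x b.length
    have hz := hG l (x a.right)
    set z := Cactus.comm l (x a.right)
    have hw := hG m (x b.right)
    set w := Cactus.comm m (x b.right)
    have hv := hG l m
    calc l * z * (m * w) = l * (z * m) * w := by group
      _ = l * m * z * w := by rw [(hz m).eq]; group
      _ = m * (l * Cactus.comm l m) * z * w := by rw [mul_comm_eq l m]; group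
      _ = m * (Cactus.comm l m * (l * z) * w) := by rw [← (hv l).eq]; group
      _ = m * (Cactus.comm l m * w) * (l * z) := by
        rw [mul_assoc (Cactus.comm l m), ← (hw (l * z)).eq]; group

end Relations

/-! ### Class two from generators, and the universal property of `G/Γ_3(G)` -/

section Generation

open scoped commutatorElement

variable {G : Type*} [Group G]

theorem commute_of_commute_generators {S : Set G} (hS : Subgroup.closure S = ⊤) {z : G}
    (hz : ∀ s ∈ S, Commute z s) (g : G) : Commute z g := by
  have h : Subgroup.closure S ≤ Subgroup.centralizer {z} := by
    rw [Subgroup.closure_le]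
    intro s hs
    rw [SetLike.mem_coe, Subgroup.mem_centralizer_singleton_iff]
    exact (hz s hs).symm.eq
  have hg : g ∈ Subgroup.centralizer {z} := h (hS ▸ Subgroup.mem_top g)
  exact (Subgroup.mem_centralizer_singleton_iff.1 hg).symm

theorem commute_of_pairwise_generators {S : Set G} (hS : Subgroup.closure S = ⊤)
    (h : ∀ s ∈ S, ∀ t ∈ S, Commute s t) (a b : G) : Commute a b :=
  commute_of_commute_generators hS (fun s hs => (commute_of_commute_generators hS (fun t ht => h s hs t ht) a).symm) b

theorem closure_range_mk_eq_top {ι : Type*} {x : ι → G}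
    (hx : Subgroup.closure (Set.range x) = ⊤) (N : Subgroup G) [N.Normal] :
    Subgroup.closure (Set.range fun i => (x i : G ⧸ N)) = ⊤ := by
  have h : (Set.range fun i => (x i : G ⧸ N)) = QuotientGroup.mk' N '' Set.range x := by
    rw [← Set.range_comp]; rfl
  rw [h, ← MonoidHom.map_closure, hx, ← MonoidHom.range_eq_map, MonoidHom.range_eq_top]
  exact QuotientGroup.mk'_surjective N

theorem comm_mem_iff_commute_mk (N : Subgroup G) [N.Normal] (a b : G) :
    comm a b ∈ N ↔ Commute (a : G ⧸ N) (b : G ⧸ N) := by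
  rw [← QuotientGroup.eq_one_iff, ← comm_eq_one_iff]
  exact Iff.rfl

theorem comm_mem_of_generators {ι : Type*} {x : ι → G}
    (hx : Subgroup.closure (Set.range x) = ⊤) (N : Subgroup G) [N.Normal]
    (h : ∀ i j, comm (x i) (x j) ∈ N) (a b : G) : comm a b ∈ N := by
  rw [comm_mem_iff_commute_mk]
  refine commute_of_pairwise_generators (closure_range_mk_eq_top hx N) ?_ _ _
  rintro _ ⟨i, rfl⟩ _ ⟨j, rfl⟩
  exact (comm_mem_iff_commute_mk N _ _).1 (h i j)

/-- Commutators of generators are central, since they commute with generators; hence the quotient by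
the center is abelian and every commutator is central. -/
theorem IsClassTwo.of_generators {ι : Type*} {x : ι → G}
    (hx : Subgroup.closure (Set.range x) = ⊤)
    (h : ∀ i j k, comm (comm (x i) (x j)) (x k) = 1) : IsClassTwo G := by
  intro a b c
  have hc := comm_mem_of_generators hx (Subgroup.center G) (fun i j => by
    rw [Subgroup.mem_center_iff]
    intro g
    refine (commute_of_commute_generators hx ?_ g).symm.eq
    rintro _ ⟨k, rfl⟩
    exact comm_eq_one_iff.1 (h i j k)) a b
  exact (Subgroup.mem_center_iff.1 hc c).symm

theorem comm_eq_commutatorElement (a b : G) : comm a b = ⁅a⁻¹, b⁻¹⁆ := by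
  simp [comm, commutatorElement_def]

theorem isClassTwo_quotient_Gamma_three : IsClassTwo (G ⧸ Gamma 3 G) := by
  intro a b c
  induction a using QuotientGroup.induction_on with | _ a
  induction b using QuotientGroup.induction_on with | _ b
  induction c using QuotientGroup.induction_on with | _ c
  rw [← comm_eq_one_iff]
  change ((comm (comm a b) c : G) : G ⧸ Gamma 3 G) = 1
  rw [QuotientGroup.eq_one_iff, comm_eq_commutatorElement (comm a b)]
  refine Subgroup.commutator_mem_commutator (inv_mem ?_) (Subgroup.mem_top _)
  rw [comm_eq_commutatorElement]
  exact Subgroup.commutator_mem_commutator (Subgroup.mem_top _) (Subgroup.mem_top _)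

theorem IsClassTwo.Gamma_three_eq_bot (hG : IsClassTwo G) : Gamma 3 G = ⊥ := by
  rw [eq_bot_iff]
  refine Subgroup.commutator_le.2 fun z hz c _ => ?_
  have h : (⊤ : Subgroup G).lowerCentralSeries 1 ≤ Subgroup.center G := by
    refine Subgroup.commutator_le.2 fun a _ b _ => ?_
    rw [Subgroup.mem_center_iff]
    intro g
    have := hG a⁻¹ b⁻¹ g
    rw [comm_eq_commutatorElement, inv_inv, inv_inv] at this
    exact this.symm.eq
  rw [Subgroup.mem_bot, commutatorElement_eq_one_iff_mul_comm]
  exact (Subgroup.mem_center_iff.1 (h hz) c).symm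

theorem IsClassTwo.Gamma_three_le_ker {H : Type*} [Group H] (hG : IsClassTwo G) (f : H →* G) :
    Gamma 3 H ≤ f.ker := by
  rw [← Subgroup.map_eq_bot_iff, eq_bot_iff, ← hG.Gamma_three_eq_bot]
  exact (Subgroup.map_lowerCentralSeries (S := ⊤) f 2).le.trans
    (Subgroup.lowerCentralSeries_mono 2 le_top)

end Generation

/-! ### The explicit presentation of `J_n/Γ_3(J_n)` -/

section Presentation

variable {n : ℕ} {G : Type*} [Group G]

/-- The group given by the explicit presentation of `J_n/Γ_3(J_n)`. -/
abbrev ExplicitQuotient (n : ℕ) : Type :=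
  PresentedGroup {w : FreeGroup (Set.Icc 2 n) | IsQuotientRelator n w}

theorem cactusRelations_of :
    CactusRelations (PresentedGroup.of : Gen n → J n) where
  sq a := PresentedGroup.one_of_mem (IsRelator.sq a)
  disjoint a b h := PresentedGroup.mk_eq_mk_of_mul_inv_mem (IsRelator.disjoint a b h)
  nested a b hp hq := PresentedGroup.mk_eq_mk_of_mul_inv_mem (IsRelator.nested a b hp hq)

theorem CactusRelations.map {H : Type*} [Group H] {f : Gen n → G} (hf : CactusRelations f)
    (φ : G →* H) : CactusRelations fun a => φ (f a) where
  sq a := by rw [← map_pow, hf.sq, map_one]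
  disjoint a b h := by rw [← map_mul, hf.disjoint a b h, map_mul]
  nested a b hp hq := by rw [← map_mul, hf.nested a b hp hq, map_mul]

theorem CactusRelations.lift_eq_one {f : Gen n → G} (hf : CactusRelations f) :
    ∀ r ∈ {w : FreeGroup (Gen n) | IsRelator n w}, FreeGroup.lift f r = 1 := by
  rintro _ (a | ⟨a, b, h⟩ | ⟨a, b, hp, hq⟩)
  · simpa using hf.sq a
  · simpa [-mul_inv_rev] using mul_inv_eq_one.2 (hf.disjoint a b h)
  · simpa [-mul_inv_rev] using mul_inv_eq_one.2 (hf.nested a b hp hq)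

theorem quotientRelations_of :
    QuotientRelations (PresentedGroup.of : Set.Icc 2 n → ExplicitQuotient n) where
  sq i := PresentedGroup.one_of_mem (IsQuotientRelator.sq i)
  comm i j h := PresentedGroup.one_of_mem (IsQuotientRelator.comm i j h)
  triple i j k := PresentedGroup.one_of_mem (IsQuotientRelator.triple i j k)
  parity i j k hj hk h :=
    PresentedGroup.mk_eq_mk_of_mul_inv_mem (IsQuotientRelator.parity i j k hj hk h)

theorem QuotientRelations.lift_eq_one {x : Set.Icc 2 n → G} (hx : QuotientRelations x) :
    ∀ r ∈ {w : FreeGroup (Set.Icc 2 n) | IsQuotientRelator n w}, FreeGroup.lift x r = 1 := by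
  rintro _ (i | ⟨i, j, h⟩ | ⟨i, j, k⟩ | ⟨i, j, k, hj, hk, h⟩)
  · simpa using hx.sq i
  · simpa [map_comm] using hx.comm i j h
  · simpa [map_comm] using hx.triple i j k
  · simpa [map_comm] using mul_inv_eq_one.2 (hx.parity i j k hj hk h)

theorem isClassTwo_explicitQuotient : IsClassTwo (ExplicitQuotient n) :=
  IsClassTwo.of_generators (PresentedGroup.closure_range_of _) quotientRelations_of.triple

/-- The homomorphism `J_n/Γ_3(J_n) → G` given by a family satisfying the explicit relations. -/
def QuotientRelations.quotientLift (hG : IsClassTwo G) {x : Set.Icc 2 n → G}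
    (hx : QuotientRelations x) : J n ⧸ Gamma 3 (J n) →* G :=
  QuotientGroup.lift _ (PresentedGroup.toGroup (hx.cactusRelations hG).lift_eq_one)
    (hG.Gamma_three_le_ker _)

theorem QuotientRelations.quotientLift_of (hG : IsClassTwo G) {x : Set.Icc 2 n → G}
    (hx : QuotientRelations x) (a : Gen n) :
    hx.quotientLift hG (QuotientGroup.mk (PresentedGroup.of a)) = extend x a :=
  PresentedGroup.toGroup.of (hx.cactusRelations hG).lift_eq_one

theorem cactusRelations_mk :
    CactusRelations fun a : Gen n => QuotientGroup.mk' (Gamma 3 (J n)) (PresentedGroup.of a) :=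
  cactusRelations_of.map _

theorem quotientRelations_sigma :
    QuotientRelations fun i : Set.Icc 2 n => (QuotientGroup.mk (sigma i) : J n ⧸ Gamma 3 (J n)) :=
  cactusRelations_mk.quotientRelations isClassTwo_quotient_Gamma_three

theorem map_extend {H : Type*} [Group H] (φ : G →* H) (x : Set.Icc 2 n → G) (a : Gen n) :
    φ (extend x a) = extend (fun i => φ (x i)) a := by
  simp [extend, map_comm]

/-- The isomorphism from the explicitly presented group to `J_n/Γ_3(J_n)`. -/
def explicitQuotientEquiv (n : ℕ) : ExplicitQuotient n ≃* J n ⧸ Gamma 3 (J n) :=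
  MonoidHom.toMulEquiv (PresentedGroup.toGroup quotientRelations_sigma.lift_eq_one)
    (quotientRelations_of.quotientLift isClassTwo_explicitQuotient)
    (PresentedGroup.ext fun i => by
      rw [MonoidHom.comp_apply, PresentedGroup.toGroup.of]
      exact (QuotientRelations.quotientLift_of _ _ _).trans (extend_initial _ i))
    (QuotientGroup.monoidHom_ext _ (PresentedGroup.ext fun a => by
      change PresentedGroup.toGroup quotientRelations_sigma.lift_eq_one (quotientRelations_of.quotientLift
        isClassTwo_explicitQuotient
        (QuotientGroup.mk (PresentedGroup.of a))) = _
      -- A general `σ_{p,q}` is recovered from the classes of the `σ_i` by `extend_eq`.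
      rw [QuotientRelations.quotientLift_of, map_extend]
      simp only [PresentedGroup.toGroup.of]
      exact congrFun cactusRelations_mk.extend_eq a))

theorem explicitQuotientEquiv_of (i : Set.Icc 2 n) :
    explicitQuotientEquiv n (PresentedGroup.of i) = QuotientGroup.mk (sigma i) :=
  PresentedGroup.toGroup.of quotientRelations_sigma.lift_eq_one

end Presentation

/-! ### Upper bound for the order -/

section UpperBound

variable {G : Type*} [Group G]

/-- The product of the cyclic groups generated by the `g i`, each of order at most two, maps onto
the closure. -/
theorem card_closure_involutions_le {ι : Type*} [Fintype ι] {g : ι → G}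
    (hc : ∀ i j, Commute (g i) (g j)) (hg : ∀ i, g i ^ 2 = 1) :
    Finite (Subgroup.closure (Set.range g)) ∧
      Nat.card (Subgroup.closure (Set.range g)) ≤ 2 ^ Fintype.card ι := by
  have hcomm : Pairwise fun i j : ι => ∀ x y : G, x ∈ Subgroup.zpowers (g i) →
      y ∈ Subgroup.zpowers (g j) → Commute x y := by
    rintro i j - _ _ ⟨a, rfl⟩ ⟨b, rfl⟩
    exact (hc i j).zpow_zpow a b
  have hfin : ∀ i, Finite (Subgroup.zpowers (g i)) := fun i =>
    (isOfFinOrder_iff_pow_eq_one.2 ⟨2, two_pos, hg i⟩).finite_zpowers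
  have hr : (Subgroup.noncommPiCoprod hcomm).range = Subgroup.closure (Set.range g) := by
    rw [Subgroup.noncommPiCoprod_range, ← Set.iUnion_singleton_eq_range, Subgroup.closure_iUnion]
    simp only [Subgroup.zpowers_eq_closure]
  rw [← hr]
  have hs := (Subgroup.noncommPiCoprod hcomm).rangeRestrict_surjective
  refine ⟨Finite.of_surjective _ hs, (Nat.card_le_card_of_surjective _ hs).trans ?_⟩
  rw [Nat.card_pi]
  refine (Finset.prod_le_pow_card _ _ 2 fun i _ => ?_).trans_eq (by rw [Finset.card_univ])
  rw [Nat.card_zpowers]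
  exact orderOf_le_of_pow_eq_one two_pos (hg i)

end UpperBound

/-- The indices `i` of the generators with `[σ_i, σ_{i+1}] ≠ 1` in `J_n/Γ_3(J_n)`. -/
abbrev CentralIndex (n : ℕ) : Type :=
  {m : Set.Icc 2 n // (n + 1) / 2 ≤ (m : ℕ) ∧ (m : ℕ) < n}

/-- The successor of an index. -/
def CentralIndex.succ {n : ℕ} (m : CentralIndex n) : Set.Icc 2 n :=
  ⟨m.1 + 1, by have := m.1.2.1; omega, m.2.2⟩

theorem card_Icc_two (n : ℕ) : Fintype.card (Set.Icc 2 n) = n - 1 := by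
  simp

theorem card_centralIndex {n : ℕ} (hn : 3 ≤ n) : Fintype.card (CentralIndex n) = n / 2 := by
  -- Since `3 ≤ n`, `(n + 1) / 2` is at least 2, so the lower bound of `Set.Icc 2 n` excludes
  -- nothing.
  let e : CentralIndex n ≃ Set.Ico ((n + 1) / 2) n :=
    { toFun m := ⟨m.1, m.2⟩
      invFun m := ⟨⟨m.1, by have := m.2.1; omega, m.2.2.le⟩, m.2⟩
      left_inv _ := rfl
      right_inv _ := rfl }
  rw [Fintype.card_congr e]
  simp only [Fintype.card_ofFinset, Nat.card_Ico]
  omega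

section Explicit

variable {n : ℕ} {G : Type*} [Group G]

theorem QuotientRelations.comm_mem_closure {x : Set.Icc 2 n → G}
    (hx : QuotientRelations x) (i j : Set.Icc 2 n) :
    Cactus.comm (x i) (x j) ∈ Subgroup.closure
      (Set.range fun m : CentralIndex n => Cactus.comm (x m.1) (x m.succ)) := by
  wlog hij : (i : ℕ) ≤ j generalizing i j
  · rw [← comm_inv]
    exact inv_mem (this j i (le_of_not_ge hij))
  by_cases h : (i : ℕ) < (n + 1) / 2 ∨ (j : ℕ) ≡ i [MOD 2]
  · rw [hx.comm i j h]
    exact one_mem _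
  · rw [not_or] at h
    obtain ⟨h1, h2⟩ := h
    unfold Nat.ModEq at h2
    have hj := j.2.2
    let m : CentralIndex n := ⟨i, by omega, by omega⟩
    rw [hx.parity i j m.succ hij (by simp only [m, CentralIndex.succ]; omega)
      (by simp only [m, CentralIndex.succ, Nat.ModEq]; omega)]
    exact Subgroup.subset_closure ⟨m, rfl⟩

/-- The second factor bounds the central subgroup `Z` generated by the commutators `[x_m, x_{m+1}]`;
the first bounds `G ⧸ Z`, where the images of the `x i` are commuting involutions. -/
theorem QuotientRelations.card_le (hG : IsClassTwo G) {x : Set.Icc 2 n → G}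
    (hx : QuotientRelations x) (hgen : Subgroup.closure (Set.range x) = ⊤) :
    Finite G ∧ Nat.card G ≤ 2 ^ (n - 1) * 2 ^ Fintype.card (CentralIndex n) := by
  set c := fun m : CentralIndex n => Cactus.comm (x m.1) (x m.succ) with hc
  set Z := Subgroup.closure (Set.range c) with hZ
  have hZc : Z ≤ Subgroup.center G := by
    rw [hZ, Subgroup.closure_le]
    rintro _ ⟨m, rfl⟩
    exact Subgroup.mem_center_iff.2 fun g => (hG _ _ g).symm.eq
  have : Z.Normal := ⟨fun z hz g => by
    rwa [Subgroup.mem_center_iff.1 (hZc hz) g, mul_inv_cancel_right]⟩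
  obtain ⟨hfZ, hcZ⟩ := card_closure_involutions_le (g := c) (fun i j => hG _ _ _)
    fun m => by rw [_root_.sq]; exact hG.comm_sq (hx.sq _) _
  obtain ⟨hfQ, hcQ⟩ := card_closure_involutions_le (g := fun i => (x i : G ⧸ Z))
    (fun i j => (comm_mem_iff_commute_mk Z _ _).1 (hx.comm_mem_closure i j))
    (fun i => by rw [← QuotientGroup.mk_pow, hx.sq, QuotientGroup.mk_one])
  rw [closure_range_mk_eq_top hgen Z] at hfQ hcQ
  rw [Subgroup.card_top, card_Icc_two] at hcQ
  have : Finite (G ⧸ Z) := Finite.of_equiv _ (Subgroup.topEquiv (G := G ⧸ Z)).toEquiv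
  have : Finite Z := hfZ
  refine ⟨Finite.of_equiv _ (Subgroup.groupEquivQuotientProdSubgroup (s := Z)).symm, ?_⟩
  rw [Subgroup.card_eq_card_quotient_mul_card_subgroup Z]
  exact Nat.mul_le_mul hcQ hcZ

end Explicit

/-! ### A central extension attaining the bound -/

section Model

/-- The central extension of `V` by `A` with the bilinear cocycle `B`. -/
@[ext]
structure CocycleExtension {V A : Type*} [AddCommGroup V] [AddCommGroup A]
    (B : V →+ V →+ A) where
  base : V
  fiber : A

namespace CocycleExtension

variable {V A : Type*} [AddCommGroup V] [AddCommGroup A] {B : V →+ V →+ A}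

instance : Mul (CocycleExtension B) where
  mul g h := ⟨g.base + h.base, g.fiber + h.fiber + B g.base h.base⟩

instance : One (CocycleExtension B) where
  one := ⟨0, 0⟩

instance : Inv (CocycleExtension B) where
  inv g := ⟨-g.base, -g.fiber + B g.base g.base⟩

@[simp] theorem base_mul (g h : CocycleExtension B) : (g * h).base = g.base + h.base := rfl

@[simp] theorem fiber_mul (g h : CocycleExtension B) :
    (g * h).fiber = g.fiber + h.fiber + B g.base h.base := rfl

@[simp] theorem base_one : (1 : CocycleExtension B).base = 0 := rfl

@[simp] theorem fiber_one : (1 : CocycleExtension B).fiber = 0 := rfl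

@[simp] theorem base_inv (g : CocycleExtension B) : g⁻¹.base = -g.base := rfl

@[simp] theorem fiber_inv (g : CocycleExtension B) :
    g⁻¹.fiber = -g.fiber + B g.base g.base := rfl

instance : Group (CocycleExtension B) where
  mul_assoc a b c := by
    ext
    · simp [add_assoc]
    · simp only [fiber_mul, base_mul, map_add, AddMonoidHom.add_apply]; abel
  one_mul a := by ext <;> simp
  mul_one a := by ext <;> simp
  inv_mul_cancel a := by ext <;> simp

theorem comm_eq (g h : CocycleExtension B) :
    comm g h = ⟨0, B g.base h.base - B h.base g.base⟩ := by
  ext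
  · simp [comm]
  · simp only [comm, fiber_mul, base_mul, fiber_inv, base_inv, map_add, map_neg,
      AddMonoidHom.add_apply, AddMonoidHom.neg_apply]
    abel

theorem card_eq (B : V →+ V →+ A) :
    Nat.card (CocycleExtension B) = Nat.card V * Nat.card A := by
  rw [← Nat.card_prod]
  exact Nat.card_congr ⟨fun g => (g.base, g.fiber), fun g => ⟨g.1, g.2⟩, fun _ => rfl, fun _ => rfl⟩

/-- The inclusion of the kernel of the extension. -/
def inr (B : V →+ V →+ A) : Multiplicative A →* CocycleExtension B where
  toFun a := ⟨0, a.toAdd⟩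
  map_one' := rfl
  map_mul' a b := by ext <;> simp

/-- The projection of the extension onto its base. -/
def proj (B : V →+ V →+ A) : CocycleExtension B →* Multiplicative V where
  toFun g := Multiplicative.ofAdd g.base
  map_one' := rfl
  map_mul' _ _ := rfl

theorem subgroup_eq_top (H : Subgroup (CocycleExtension B))
    (hr : ∀ a, inr B a ∈ H) (hp : ∀ v, ∃ g ∈ H, proj B g = v) : H = ⊤ := by
  rw [eq_top_iff]
  intro g _
  obtain ⟨h, hh, hg⟩ := hp (proj B g)
  have hb : h.base = g.base := hg
  have e : g = h * inr B (Multiplicative.ofAdd (g.fiber - h.fiber)) := by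
    ext <;> simp [inr, hb]
  rw [e]
  exact H.mul_mem hh (hr _)

end CocycleExtension

/-- A subgroup of `Multiplicative (ι → ZMod 2)` containing the standard basis is everything. -/
theorem pi_zmod_two_mem {ι : Type*} [Fintype ι] [DecidableEq ι]
    (H : Subgroup (Multiplicative (ι → ZMod 2)))
    (h : ∀ i, Multiplicative.ofAdd (Pi.single i (1 : ZMod 2)) ∈ H) (v) : v ∈ H := by
  have e : v = ∏ i, Multiplicative.ofAdd (Pi.single i (v.toAdd i)) := by
    rw [← ofAdd_sum, Finset.univ_sum_single]
    rfl
  rw [e]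
  refine H.prod_mem fun i _ => ?_
  have h2 : ∀ c : ZMod 2, c = 0 ∨ c = 1 := by decide
  rcases h2 (v.toAdd i) with h0 | h1
  · rw [h0, Pi.single_zero]
    exact H.one_mem
  · rw [h1]
    exact h i

variable (n : ℕ)

/-- The linear form `w ↦ ∑ w_l` over the `l > m` with `l ≢ m mod 2`. -/
def upperForm (m : Set.Icc 2 n) : (Set.Icc 2 n → ZMod 2) →+ ZMod 2 :=
  ∑ l : Set.Icc 2 n, if (m : ℕ) < l ∧ ¬ (l : ℕ) ≡ m [MOD 2] then Pi.evalAddMonoidHom _ l else 0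

theorem upperForm_single (m l : Set.Icc 2 n) :
    upperForm n m (Pi.single l 1) =
      if (m : ℕ) < l ∧ ¬ (l : ℕ) ≡ m [MOD 2] then 1 else 0 := by
  rw [upperForm, AddMonoidHom.finsetSum_apply, Finset.sum_eq_single l]
  · split_ifs <;> simp
  · intro k _ hk
    split_ifs <;> simp [hk]
  · simp

/-- The cocycle `(v, w) ↦ (v_m ∑ w_l)_m`, where `l` runs over `l > m` with `l ≢ m mod 2`. -/
def modelCocycle : (Set.Icc 2 n → ZMod 2) →+ (Set.Icc 2 n → ZMod 2) →+
    (CentralIndex n → ZMod 2) :=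
  AddMonoidHom.mk' (fun v => AddMonoidHom.mk' (fun w m => v m.1 * upperForm n m.1 w)
    fun w w' => by ext m; simp [mul_add])
    fun v v' => by ext w m; simp [add_mul]

theorem modelCocycle_single (i j : Set.Icc 2 n) (m : CentralIndex n) :
    modelCocycle n (Pi.single i 1) (Pi.single j 1) m =
      if m.1 = i ∧ (i : ℕ) < j ∧ ¬ (j : ℕ) ≡ i [MOD 2] then 1 else 0 := by
  change (Pi.single i 1 : Set.Icc 2 n → ZMod 2) m.1 * upperForm n m.1 (Pi.single j 1) = _
  rw [upperForm_single]
  by_cases h : m.1 = i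
  · subst h; simp
  · simp [h]

/-- A group of order `2^{⌊n/2⌋+n-1}` realizing the explicit presentation. -/
abbrev Model : Type := CocycleExtension (modelCocycle n)

/-- The generators of the model. -/
def Model.gen (i : Set.Icc 2 n) : Model n := ⟨Pi.single i 1, 0⟩

/-- The commutator is the antisymmetrized cocycle. The cocycle sees only pairs with the smaller
index first, so at most one of the two terms is nonzero. -/
theorem Model.comm_gen (i j : Set.Icc 2 n) :
    comm (Model.gen n i) (Model.gen n j) = ⟨0, fun m =>
      (if m.1 = i ∧ (i : ℕ) < j ∧ ¬ (j : ℕ) ≡ i [MOD 2] then 1 else 0) -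
      (if m.1 = j ∧ (j : ℕ) < i ∧ ¬ (i : ℕ) ≡ j [MOD 2] then 1 else 0)⟩ := by
  rw [CocycleExtension.comm_eq]
  ext m
  · rfl
  · simp only [Model.gen, Pi.sub_apply, modelCocycle_single]

theorem Model.quotientRelations : QuotientRelations (Model.gen n) where
  sq i := by
    rw [_root_.sq]
    ext m
    · exact CharTwo.add_self_eq_zero ((Pi.single i 1 : Set.Icc 2 n → ZMod 2) m)
    · simp [Model.gen, modelCocycle_single]
  comm i j h := by
    rw [Model.comm_gen]
    ext m
    · rfl
    · have hm := m.2.1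
      dsimp only
      rw [if_neg, if_neg]
      · simp
      · rintro ⟨rfl, h1, h2⟩
        exact h.elim (fun h => by omega) fun h => h2 h.symm
      · rintro ⟨rfl, h1, h2⟩
        exact h.elim (fun h => by omega) fun h => h2 h
  triple i j k := by
    rw [CocycleExtension.comm_eq, CocycleExtension.comm_eq]
    ext <;> simp
  parity i j k hj hk h := by
    rw [Model.comm_gen, Model.comm_gen]
    ext m
    · rfl
    · unfold Nat.ModEq at *
      dsimp only
      congr 1
      · refine if_congr (and_congr_right fun _ => ?_) rfl rfl
        omega
      · rw [if_neg (by omega), if_neg (by omega)]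

theorem Model.closure_range_gen : Subgroup.closure (Set.range (Model.gen n)) = ⊤ := by
  set H := Subgroup.closure (Set.range (Model.gen n))
  have hg : ∀ i, Model.gen n i ∈ H := fun i => Subgroup.subset_closure ⟨i, rfl⟩
  refine CocycleExtension.subgroup_eq_top H ?_ ?_
  · refine fun a => pi_zmod_two_mem (H.comap (CocycleExtension.inr _)) (fun m => ?_) a
    -- Each basis vector of the fiber is the commutator of two consecutive generators.
    have e : CocycleExtension.inr (modelCocycle n)
        (Multiplicative.ofAdd (Pi.single m (1 : ZMod 2))) =
        comm (Model.gen n m.1) (Model.gen n m.succ) := by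
      rw [Model.comm_gen]
      ext k
      · rfl
      · change (Pi.single m 1 : CentralIndex n → ZMod 2) k = _
        have hs : (m.succ : ℕ) = m.1 + 1 := rfl
        have h1 : ¬ (k.1 = m.succ ∧ (m.succ : ℕ) < m.1 ∧ ¬ (m.1 : ℕ) ≡ m.succ [MOD 2]) := by
          omega
        have h2 : k = m ↔ k.1 = m.1 ∧ (m.1 : ℕ) < m.succ ∧ ¬ (m.succ : ℕ) ≡ m.1 [MOD 2] := by
          rw [Subtype.ext_iff]
          unfold Nat.ModEq
          exact ⟨fun h => ⟨h, by omega, by omega⟩, fun h => h.1⟩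
        dsimp only
        rw [if_neg h1, sub_zero, Pi.single_apply]
        exact if_congr h2 rfl rfl
    rw [Subgroup.mem_comap, e]
    exact H.mul_mem (H.mul_mem (H.mul_mem (H.inv_mem (hg _)) (H.inv_mem (hg _))) (hg _)) (hg _)
  · refine fun v => pi_zmod_two_mem (H.map (CocycleExtension.proj _)) (fun i => ?_) v
    exact ⟨_, hg i, rfl⟩

theorem Model.card : Nat.card (Model n) = 2 ^ (n - 1) * 2 ^ Fintype.card (CentralIndex n) := by
  rw [CocycleExtension.card_eq, Nat.card_fun, Nat.card_fun, Nat.card_zmod,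
    Nat.card_eq_fintype_card, Nat.card_eq_fintype_card, card_Icc_two]

end Model

/-! ### The exact order, and recognition of the quotient by its order -/

section Order

variable {n : ℕ} {G : Type*} [Group G]

/-- The homomorphism from the explicitly presented group given by a family of elements. -/
def QuotientRelations.lift {x : Set.Icc 2 n → G} (hx : QuotientRelations x) :
    ExplicitQuotient n →* G :=
  PresentedGroup.toGroup hx.lift_eq_one

theorem QuotientRelations.lift_surjective {x : Set.Icc 2 n → G} (hx : QuotientRelations x)
    (hgen : Subgroup.closure (Set.range x) = ⊤) : Function.Surjective hx.lift := by
  rw [← MonoidHom.range_eq_top, eq_top_iff, ← hgen, Subgroup.closure_le]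
  rintro _ ⟨i, rfl⟩
  exact ⟨PresentedGroup.of i, PresentedGroup.toGroup.of hx.lift_eq_one⟩

theorem finite_explicitQuotient (n : ℕ) : Finite (ExplicitQuotient n) :=
  (quotientRelations_of.card_le isClassTwo_explicitQuotient
    (PresentedGroup.closure_range_of _)).1

theorem card_explicitQuotient (hn : 3 ≤ n) :
    Nat.card (ExplicitQuotient n) = 2 ^ (n / 2 + n - 1) := by
  have hfin := finite_explicitQuotient n
  have hle := (quotientRelations_of (n := n)).card_le isClassTwo_explicitQuotient
    (PresentedGroup.closure_range_of _)
  have hge := Nat.card_le_card_of_surjective _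
    ((Model.quotientRelations n).lift_surjective (Model.closure_range_gen n))
  rw [Model.card] at hge
  rw [le_antisymm hle.2 hge, card_centralIndex hn, ← pow_add]
  congr 1
  omega

/-- A generating family satisfying the explicit relations, in a group of the order of the explicitly
presented group, yields an isomorphism. -/
theorem QuotientRelations.nonempty_mulEquiv {x : Set.Icc 2 n → G} (hx : QuotientRelations x)
    (hgen : Subgroup.closure (Set.range x) = ⊤)
    (hcard : Nat.card G = Nat.card (ExplicitQuotient n)) :
    Nonempty (J n ⧸ Gamma 3 (J n) ≃* G) := by
  have := finite_explicitQuotient n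
  have hb : Function.Bijective hx.lift :=
    (Nat.bijective_iff_surjective_and_card _).2 ⟨hx.lift_surjective hgen, hcard.symm⟩
  exact ⟨(explicitQuotientEquiv n).symm.trans (MulEquiv.ofBijective _ hb)⟩

end Order

/-! ### The cases `n = 4` and `n = 5` -/

section Wreath

/-- The regular wreath product `ℤ₂² ≀ ℤ₂`. -/
abbrev Wreath : Type := (Z2 × Z2) ≀ᵣ Z2

instance : DecidableEq Wreath := fun g h =>
  decidable_of_iff (g.left = h.left ∧ g.right = h.right) RegularWreathProduct.ext_iff.symm

/-- The nontrivial element of the cyclic group of order two. -/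
def swap : Z2 := Multiplicative.ofAdd 1

/-- The function `ℤ₂ → ℤ₂²` with the given values at `1` and at the nontrivial element. -/
def pairFun (u v : Z2 × Z2) : Z2 → Z2 × Z2 := fun t => if t = 1 then u else v

theorem pairFun_eq (f : Z2 → Z2 × Z2) : pairFun (f 1) (f swap) = f := by
  funext t
  have h : ∀ t : Z2, t = 1 ∨ t = swap := by decide
  rcases h t with rfl | rfl <;> rfl

/-- Generators of `ℤ₂² ≀ ℤ₂` corresponding to `σ_2, σ_3, σ_4`. -/
def wreathGen (i : Set.Icc 2 4) : Wreath :=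
  if (i : ℕ) = 2 then ⟨pairFun (swap, 1) 1, 1⟩
  else if (i : ℕ) = 3 then ⟨1, swap⟩
  else ⟨pairFun (1, swap) 1, 1⟩

theorem forall_Icc_two_four {P : Set.Icc 2 4 → Prop} (h2 : P ⟨2, by decide⟩)
    (h3 : P ⟨3, by decide⟩) (h4 : P ⟨4, by decide⟩) (i : Set.Icc 2 4) : P i := by
  obtain ⟨i, hi, hi'⟩ := i
  interval_cases i
  exacts [h2, h3, h4]

theorem wreathGen_quotientRelations : QuotientRelations wreathGen where
  sq := forall_Icc_two_four (by decide) (by decide) (by decide)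
  comm := by decide
  triple := by decide
  parity := by decide

/-- `x_2` and `x_4` generate the copy of `ℤ₂²` at the coordinate `1`; conjugation by the involution
`x_3` moves it to the other coordinate. -/
theorem wreath_eq_word (a b c d q : Z2) :
    (⟨pairFun (a, b) (c, d), q⟩ : Wreath) =
      wreathGen ⟨2, by decide⟩ ^ a.toAdd.val * wreathGen ⟨4, by decide⟩ ^ b.toAdd.val *
      (wreathGen ⟨3, by decide⟩ * wreathGen ⟨2, by decide⟩ ^ c.toAdd.val *
        wreathGen ⟨4, by decide⟩ ^ d.toAdd.val * wreathGen ⟨3, by decide⟩) *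
      wreathGen ⟨3, by decide⟩ ^ q.toAdd.val := by
  revert a b c d q
  decide

theorem closure_range_wreathGen : Subgroup.closure (Set.range wreathGen) = ⊤ := by
  rw [eq_top_iff]
  rintro ⟨f, q⟩ -
  have hg : ∀ i, wreathGen i ∈ Subgroup.closure (Set.range wreathGen) :=
    fun i => Subgroup.subset_closure ⟨i, rfl⟩
  rw [← pairFun_eq f, wreath_eq_word]
  exact mul_mem (mul_mem (mul_mem (pow_mem (hg _) _) (pow_mem (hg _) _))
    (mul_mem (mul_mem (mul_mem (hg _) (pow_mem (hg _) _)) (pow_mem (hg _) _)) (hg _)))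
    (pow_mem (hg _) _)

theorem card_Z2 : Nat.card Z2 = 2 := by simp

theorem card_wreath : Nat.card Wreath = 32 := by
  norm_num [RegularWreathProduct.card, Nat.card_prod, card_Z2]

theorem nonempty_mulEquiv_wreath : Nonempty (J 4 ⧸ Gamma 3 (J 4) ≃* Wreath) :=
  wreathGen_quotientRelations.nonempty_mulEquiv closure_range_wreathGen
    (by norm_num [card_wreath, card_explicitQuotient])

/-- Generators of `ℤ₂ × (ℤ₂² ≀ ℤ₂)` corresponding to `σ_2, …, σ_5`. -/
def prodWreathGen (i : Set.Icc 2 5) : Z2 × Wreath :=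
  if h : (i : ℕ) = 2 then (swap, 1)
  else (1, wreathGen ⟨i - 1, by have := i.2.1; omega, by have := i.2.2; omega⟩)

/-- For `n = 5` the bound `⌊(n+1)/2⌋` is 3, so `x_2` commutes with every generator. The relations
among `x_3, x_4, x_5` are those for `n = 4` with indices raised by one. -/
theorem prodWreathGen_quotientRelations : QuotientRelations prodWreathGen where
  sq := by decide
  comm := by decide
  triple := by decide
  parity := by decide

theorem closure_range_prodWreathGen : Subgroup.closure (Set.range prodWreathGen) = ⊤ := by
  set H := Subgroup.closure (Set.range prodWreathGen)
  have hr : ∀ w, ((1, w) : Z2 × Wreath) ∈ H := by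
    have h : Subgroup.closure (Set.range wreathGen) ≤ H.comap (MonoidHom.inr Z2 Wreath) := by
      rw [Subgroup.closure_le]
      rintro _ ⟨i, rfl⟩
      have hi := i.2.1
      refine Subgroup.subset_closure ⟨⟨i + 1, by omega, by have := i.2.2; omega⟩, ?_⟩
      rw [prodWreathGen, dif_neg (by dsimp only; omega)]
      rfl
    intro w
    exact h (closure_range_wreathGen ▸ Subgroup.mem_top w)
  have hl : ((swap, 1) : Z2 × Wreath) ∈ H := Subgroup.subset_closure ⟨⟨2, by decide⟩, rfl⟩
  rw [eq_top_iff]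
  rintro ⟨a, w⟩ -
  have ha : ∀ a : Z2, a = 1 ∨ a = swap := by decide
  rcases ha a with rfl | rfl
  · exact hr w
  · simpa using H.mul_mem hl (hr w)

theorem nonempty_mulEquiv_prod_wreath : Nonempty (J 5 ⧸ Gamma 3 (J 5) ≃* Z2 × Wreath) :=
  prodWreathGen_quotientRelations.nonempty_mulEquiv closure_range_prodWreathGen
    (by norm_num [Nat.card_prod, card_wreath, card_Z2, card_explicitQuotient])

end Wreath

end Cactus

theorem theoremD :
    (∀ n : ℕ, 3 ≤ n →
      Nat.card (Cactus.J n ⧸ Cactus.Gamma 3 (Cactus.J n)) = 2 ^ (n / 2 + n - 1) ∧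
      ∃ e : PresentedGroup {w : FreeGroup (Set.Icc 2 n) | Cactus.IsQuotientRelator n w} ≃*
          Cactus.J n ⧸ Cactus.Gamma 3 (Cactus.J n),
        ∀ i : Set.Icc 2 n,
          e (PresentedGroup.of i) = QuotientGroup.mk (Cactus.sigma i)) ∧
    Nonempty (Cactus.J 4 ⧸ Cactus.Gamma 3 (Cactus.J 4) ≃*
      (Cactus.Z2 × Cactus.Z2) ≀ᵣ Cactus.Z2) ∧
    Nonempty (Cactus.J 5 ⧸ Cactus.Gamma 3 (Cactus.J 5) ≃*
      Cactus.Z2 × ((Cactus.Z2 × Cactus.Z2) ≀ᵣ Cactus.Z2)) := by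
  refine ⟨fun n hn => ⟨?_, Cactus.explicitQuotientEquiv n, Cactus.explicitQuotientEquiv_of⟩,
    Cactus.nonempty_mulEquiv_wreath, Cactus.nonempty_mulEquiv_prod_wreath⟩
  rw [← Nat.card_congr (Cactus.explicitQuotientEquiv n).toEquiv, Cactus.card_explicitQuotient hn]
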